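/- Let $m,n\ge 1$ and let $G$ be the $m\times n$ cylindrical Fisher graph: in the honeycomb graph on a cylinder with rows $i=0,\dots,m-1$ and cyclic columns $j\in\mathbb Z/n$, with a left and a right vertex $L_{i,j},R_{i,j}$ in each cell and with the edges $L_{i,j}R_{i,j}$ ($a$-edges), $R_{i,j}L_{i,j+1}$ ($b$-edges) and, for $i+1<m$, $R_{i,j}L_{i+1,j}$ ($c$-edges), replace every vertex by a triangle with corners $a,b,c$, the $a$-, $b$- and $c$-edges being attached to the corners of the same name (so $G$ has $6mn$ vertices). The $m$ $b$-edges from column $n-1$ to column $0$, which are crossed by a dual path $\gamma$ joining the two boundary components of the cylinder, are the $z$-edges. Fix an orientation of the edges of $G$ for which all $z$-edges cross $\gamma$ in the same direction (for instance a translation-invariant clockwise-odd orientation). Let $E$ be the set of edges. For edge weights $w\in W=(0,\infty)^{E}$ and $z\in\mathbb C\setminus\{0\}$ let $K(z)$ be the matrix indexed by the vertices with $K(z)_{u,v}=w_e$, $K(z)_{v,u}=-w_e$ if $e$ is an edge oriented from $u$ to $v$ that is not a $z$-edge, $K(z)_{u,v}=w_e z$, $K(z)_{v,u}=-w_e/z$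 if $e$ is a $z$-edge oriented from $u$ to $v$, and all other entries $0$. Let $P(z)=\det K(z)$, and let $W_0\subseteq W$ be the set of the weights with $P(1)=0$. A property is said to hold for generic points of a set $S\subseteq\mathbb R^E$ if it holds at all points of $S$ at which some real polynomial $Q$ (independent of the point) is nonzero, where $\{x\in S: Q(x)\ne0\}$ is dense in $S$. 1. If $P(1)=0$, then $\left.\frac{\partial P(z)}{\partial z}\right|_{z=1}=0$ and $\left.\frac{\partial P(e^{\sqrt{-1}\theta})}{\partial\theta}\right|_{\theta=0}=0$. 2. For generic edge weights in $W$, $\left.\frac{\partial^2 P(z)}{\partial z^2}\right|_{z=1}\ne0$ and $\left.\frac{\partial^2 P(e^{\sqrt{-1}\theta})}{\partial\theta^2}\right|_{\theta=0}\neq0$. 3. The same holds for generic edge weights in $W_0$; hence, if $P(1)=0$, then for a generic choice of edge weights the zero of $P$ at $z=1$ has multiplicity exactly $2$. -/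

import Mathlib

/-!
The `m × n` cylindrical Fisher graph (height `m`, circumference `n`), its Kasteleyn matrix `K(z)`
and its characteristic polynomial `P(z) = det K(z)`.

The cylindrical honeycomb graph has cells `(i, j)`, `i` the row and `j` the column (cyclic).
A cell holds one left and one right honeycomb vertex, and each honeycomb vertex is replaced by
a triangle with corners `a`, `b`, `c`.
-/

namespace FisherCylinder

/-- The two triangles (former honeycomb vertices) of a cell. -/
inductive Side
  | left
  | right
  deriving DecidableEq

instance : Fintype Side := ⟨{.left, .right}, by intro x; cases x <;> decide⟩

/-- The three corners of a triangle; corner `a` carries the `a`-edge of the triangle, and so on. -/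
inductive Corner
  | a
  | b
  | c
  deriving DecidableEq

instance : Fintype Corner := ⟨{.a, .b, .c}, by intro x; cases x <;> decide⟩

/-- The cyclic successor of a corner in its triangle. -/
def Corner.next : Corner → Corner
  | .a => .b
  | .b => .c
  | .c => .a

/-- A vertex of the cylindrical Fisher graph: a corner of one of the two triangles of the cell
in row `i` and column `j`. There are `6 m n` vertices. -/
abbrev Vertex (m n : ℕ) : Type := Fin m × Fin n × Side × Corner

/-- The edges of the cylindrical Fisher graph: the three sides of each triangle, one `a`-edge in
each cell, one `b`-edge from each cell to the next cell of the same row (cyclically), and one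
`c`-edge from each cell that is not in the last row to the next row. The `c`-edges that would leave
the first or the last row have been removed. -/
inductive Edge (m n : ℕ)
  | tri (i : Fin m) (j : Fin n) (s : Side) (k : Corner)
  | a (i : Fin m) (j : Fin n)
  | b (i : Fin m) (j : Fin n)
  | c (i : {i : Fin m // i.val + 1 < m}) (j : Fin n)
  deriving DecidableEq, Fintype

variable {m n : ℕ}

/-- One endpoint of an edge. -/
def Edge.fst : Edge m n → Vertex m n
  | .tri i j s k => (i, j, s, k)
  | .a i j => (i, j, .left, .a)
  | .b i j => (i, j, .right, .b)
  | .c i j => (i.1, j, .right, .c)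

/-- The other endpoint of an edge. In `Fin n` the sum `j + 1` is taken modulo `n`. -/
def Edge.snd [NeZero n] : Edge m n → Vertex m n
  | .tri i j s k => (i, j, s, k.next)
  | .a i j => (i, j, .right, .a)
  | .b i j => (i, j + 1, .left, .b)
  | .c i j => (⟨i.1.val + 1, i.2⟩, j, .left, .c)

/-- The `z`-edges: the `m` edges that are crossed by a dual path running along the cylinder from
one boundary component to the other, namely the `b`-edges from the last column to the first. -/
def Edge.IsZEdge : Edge m n → Prop
  | .b _ j => j.val + 1 = n
  | _ => False

instance : DecidablePred (Edge.IsZEdge (m := m) (n := n)) := fun e =>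
  match e with
  | .tri _ _ _ _ => inferInstanceAs (Decidable False)
  | .a _ _ => inferInstanceAs (Decidable False)
  | .b _ j => inferInstanceAs (Decidable (j.val + 1 = n))
  | .c _ _ => inferInstanceAs (Decidable False)

/-- The starting point of an edge for the orientation `o`: `o e = true` means that `e` is oriented
from `e.fst` to `e.snd`, and `o e = false` that it is oriented the other way. -/
def tail [NeZero n] (o : Edge m n → Bool) (e : Edge m n) : Vertex m n :=
  if o e then e.fst else e.snd

/-- The end point of an edge for the orientation `o`. -/
def head [NeZero n] (o : Edge m n → Bool) (e : Edge m n) : Vertex m n :=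
  if o e then e.snd else e.fst

/-- The `z`-edges all wind around the cylinder in the same direction. -/
def ZAligned (o : Edge m n → Bool) : Prop :=
  ∀ e e' : Edge m n, e.IsZEdge → e'.IsZEdge → o e = o e'

/-- The factor by which the entry `K_{u,v}` of an edge oriented from `u` to `v` is multiplied. -/
noncomputable def zFactor (z : ℂ) (e : Edge m n) : ℂ := if e.IsZEdge then z else 1

/-- The Kasteleyn matrix `K(z)` for the orientation `o` and the edge weights `w`: an edge `e`
oriented from `u` to `v` contributes `w e` to `K_{u,v}` and `-w e` to `K_{v,u}`, and if `e` is a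
`z`-edge, these are multiplied by `z` and by `1/z` respectively. -/
noncomputable def K [NeZero n] (o : Edge m n → Bool) (w : Edge m n → ℝ) (z : ℂ) :
    Matrix (Vertex m n) (Vertex m n) ℂ :=
  fun u v => ∑ e : Edge m n,
    ((if tail o e = u ∧ head o e = v then (w e : ℂ) * zFactor z e else 0) -
      (if tail o e = v ∧ head o e = u then (w e : ℂ) * (zFactor z e)⁻¹ else 0))

/-- The characteristic polynomial `P(z) = det K(z)`, as a function of `z`. -/
noncomputable def P [NeZero n] (o : Edge m n → Bool) (w : Edge m n → ℝ) (z : ℂ) : ℂ :=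
  (K o w z).det

/-- The characteristic polynomial on the unit circle, as a function of the angle. -/
noncomputable def PAngle [NeZero n] (o : Edge m n → Bool) (w : Edge m n → ℝ) (θ : ℝ) : ℂ :=
  P o w (Complex.exp ((θ : ℂ) * Complex.I))

/-- The positive edge weights. -/
def positiveWeights (m n : ℕ) : Set (Edge m n → ℝ) := {w | ∀ e, 0 < w e}

/-- The positive edge weights with `P(1) = 0`. -/
def criticalWeights [NeZero n] (o : Edge m n → Bool) : Set (Edge m n → ℝ) :=
  {w | w ∈ positiveWeights m n ∧ P o w 1 = 0}

/-- The property `p` holds for the generic point of `S ⊆ ℝ^ι`: it holds at every point of `S` off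
an algebraic set (the zero set of a real polynomial) whose complement in `S` is dense in `S`. -/
def HoldsGenericallyOn {ι : Type*} (S : Set (ι → ℝ)) (p : (ι → ℝ) → Prop) : Prop :=
  ∃ Q : MvPolynomial ι ℝ,
    S ⊆ closure {x | x ∈ S ∧ MvPolynomial.eval x Q ≠ 0} ∧
      ∀ x ∈ S, MvPolynomial.eval x Q ≠ 0 → p x

end FisherCylinder

/-! Transposition gives `K(z)ᵀ = -K(1/z)`, and the number of vertices is even, so `P(1/z) = P(z)`.
Hence `P'(1) = 0` for all weights, and the second derivative in the angle at `0` is `-P''(1)`. Both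
generic statements thus concern one polynomial `g = P''(1)` in the weights: it must be nonzero on a
dense subset of the positive orthant, and of the positive zeros of `det K(1)`.

For the orthant, `g ≠ 0` suffices. On the zero set, `g` must not vanish on any open piece. There
`det K(1) = f²` with `f` the Pfaffian up to sign (`isSquare_det_of_transpose_eq_neg`), and rescaling
the weights at one vertex shows that each monomial of `f` has degree one at each vertex
(`sum_mul_incidence_eq_one`). So `f` is affine in each variable, regular zeros are dense among its
zeros, and where `∂f/∂e ≠ 0` the zero set is the graph of a rational function solving for the
variable `e`. Pulled back to this graph, `g` is rational, so it vanishes on an open piece only if it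
vanishes at all zeros with `∂f/∂e ≠ 0` (`zeros_subset_closure_eval_ne_zero`). One real zero for each
`e`, positive or not, therefore decides the matter.

By Euler's identity only edges `e` on the cycle through all vertices of a row are needed. If only
matching edges, and all cycle edges of one row, carry weight, then `K` is bipartite and `P(z) = s (A
+ Bz)(A + B/z)`. Weights with `A = 1`, `B = -1` give a zero with `P''(1) = -2s ≠ 0`, and doubling
the weight of any edge of that cycle makes `P(1)` nonzero (`exists_critical_weights`). -/

/-! ### Determinants of skew-symmetric, cyclic and antidiagonal matrices -/

section SkewDeterminant

open Matrix

/-- A nonzero entry `a` splits off a 2 × 2 skew block of determinant `a²`, whose Schur complement is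
again skew and smaller by two. The induction ends at a zero matrix, of determinant `0` or, if empty,
`1`. -/
theorem isSquare_det_of_transpose_eq_neg_field {F : Type*} [Field F] [CharZero F]
    {ι : Type*} [Fintype ι] [DecidableEq ι] (A : Matrix ι ι F) (hA : Aᵀ = -A) :
    IsSquare A.det := by
  induction hN : Fintype.card ι using Nat.strong_induction_on generalizing ι with
  | _ N ih =>
  have hskew (i j : ι) : A i j = -A j i := by
    simpa using congrFun (congrFun hA j) i
  by_cases h : ∃ i j, A i j ≠ 0
  · obtain ⟨i, j, hij⟩ := h
    have hdiag (k : ι) : A k k = 0 := by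
      have := hskew k k
      exact self_eq_neg.mp this
    have hne : i ≠ j := by
      rintro rfl
      exact hij (hdiag i)
    have hf : Function.Injective ![i, j] := by
      intro a b
      fin_cases a <;> fin_cases b <;> simp [hne, hne.symm]
    classical
    let e : Fin 2 ⊕ ↥(Set.range ![i, j])ᶜ ≃ ι :=
      ((Equiv.ofInjective _ hf).sumCongr (Equiv.refl _)).trans (Equiv.Set.sumCompl _)
    have he0 : e (Sum.inl 0) = i := rfl
    have he1 : e (Sum.inl 1) = j := rfl
    set B := A.submatrix e e with hB
    have hBt : Bᵀ = -B := by
      ext a b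
      simpa [hB] using hskew (e b) (e a)
    have hdet : B.toBlocks₁₁.det = A i j * A i j := by
      rw [Matrix.det_fin_two]
      simp only [toBlocks₁₁, of_apply, hB, submatrix_apply, he0, he1, hdiag]
      rw [hskew j i]
      ring
    have hunit : IsUnit B.toBlocks₁₁.det := by
      rw [hdet]
      exact (mul_ne_zero hij hij).isUnit
    let : Invertible B.toBlocks₁₁ := Matrix.invertibleOfIsUnitDet _ hunit
    rw [← Matrix.det_submatrix_equiv_self e A, ← hB, ← Matrix.fromBlocks_toBlocks B,
      Matrix.det_fromBlocks₁₁, hdet]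
    refine IsSquare.mul ⟨_, rfl⟩ (ih _ ?_ _ ?_ rfl)
    · rw [← hN, ← Fintype.card_congr e, Fintype.card_sum]
      simp
    · have h11 : B.toBlocks₁₁ᵀ = -B.toBlocks₁₁ := by
        ext a b; exact congrFun (congrFun hBt (Sum.inl a)) (Sum.inl b)
      have h12 : B.toBlocks₁₂ᵀ = -B.toBlocks₂₁ := by
        ext a b; exact congrFun (congrFun hBt (Sum.inr a)) (Sum.inl b)
      have h21 : B.toBlocks₂₁ᵀ = -B.toBlocks₁₂ := by
        ext a b; exact congrFun (congrFun hBt (Sum.inl a)) (Sum.inr b)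
      have h22 : B.toBlocks₂₂ᵀ = -B.toBlocks₂₂ := by
        ext a b; exact congrFun (congrFun hBt (Sum.inr a)) (Sum.inr b)
      have hinv : (B.toBlocks₁₁⁻¹)ᵀ = -B.toBlocks₁₁⁻¹ := by
        rw [Matrix.transpose_nonsing_inv, h11]
        refine Matrix.inv_eq_left_inv ?_
        rw [neg_mul_neg, Matrix.nonsing_inv_mul _ hunit]
      rw [transpose_sub, transpose_mul, transpose_mul, invOf_eq_nonsing_inv, hinv, h12, h21, h22]
      simp only [Matrix.neg_mul, Matrix.mul_neg, neg_neg, Matrix.mul_assoc]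
      abel
  · push Not at h
    have : A = 0 := by ext i j; exact h i j
    subst this
    cases isEmpty_or_nonempty ι
    · simp
    · rw [Matrix.det_zero]; exact IsSquare.zero

/-- The determinant of a skew-symmetric matrix over an integrally closed domain of
characteristic zero is a square. -/
theorem isSquare_det_of_transpose_eq_neg {R : Type*} [CommRing R] [IsDomain R] [CharZero R]
    [IsIntegrallyClosed R] {ι : Type*} [Fintype ι] [DecidableEq ι] (A : Matrix ι ι R)
    (hA : Aᵀ = -A) : IsSquare A.det := by
  have hinj := IsFractionRing.injective R (FractionRing R)
  have : CharZero (FractionRing R) := charZero_of_injective_algebraMap hinj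
  obtain ⟨r, hr⟩ := isSquare_det_of_transpose_eq_neg_field (A.map (algebraMap R (FractionRing R)))
    (by
      ext i j
      simpa using congrArg (algebraMap R (FractionRing R)) (congrFun (congrFun hA i) j))
  have hr' : algebraMap R (FractionRing R) A.det = r ^ 2 := by
    rw [RingHom.map_det, sq]; exact hr
  -- The square root found in the fraction field is integral over `R`, hence lies in `R`.
  obtain ⟨s, rfl⟩ := IsIntegrallyClosed.exists_algebraMap_eq_of_isIntegral_pow (n := 2)
    two_pos (hr' ▸ isIntegral_algebraMap)
  exact ⟨s, hinj (by rw [hr', map_mul, sq])⟩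

/-- The determinant of a matrix supported on the diagonal and on the graph of a cyclic
permutation. -/
theorem det_eq_prod_add_sign_mul_prod {R : Type*} [CommRing R] {ι : Type*} [Fintype ι]
    [DecidableEq ι] (M : Matrix ι ι R) (τ : Equiv.Perm ι) (hτ1 : τ ≠ 1)
    (hM : ∀ i j, j ≠ i → j ≠ τ i → M i j = 0)
    (hτ : ∀ σ : Equiv.Perm ι, (∀ i, σ i = i ∨ σ i = τ i) → σ = 1 ∨ σ = τ) :
    M.det = ∏ i, M i i + (Equiv.Perm.sign τ : ℤ) * ∏ i, M i (τ i) := by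
  rw [← Matrix.det_transpose, Matrix.det_apply', ← Finset.sum_subset (Finset.subset_univ {1, τ}),
    Finset.sum_pair hτ1.symm]
  · simp
  · intro σ _ hσ
    have : ¬ ∀ i, σ i = i ∨ σ i = τ i := fun h => hσ (by simpa using hτ σ h)
    push Not at this
    obtain ⟨i, h1, h2⟩ := this
    rw [Finset.prod_eq_zero (Finset.mem_univ i) (by simpa using hM i _ h1 h2), mul_zero]

/-- The determinant of a block antidiagonal matrix, up to a sign depending only on the size. -/
theorem det_fromBlocks_antidiagonal {R : Type*} [CommRing R] {ι : Type*} [Fintype ι]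
    [DecidableEq ι] (B C : Matrix ι ι R) :
    (fromBlocks 0 B C 0).det =
      ((Equiv.Perm.sign (Equiv.sumComm ι ι : Equiv.Perm (ι ⊕ ι)) : ℤ) : R) * (B.det * C.det) := by
  have h : fromBlocks 0 B C 0 =
      (fromBlocks B 0 0 C).submatrix id (Equiv.sumComm ι ι : Equiv.Perm (ι ⊕ ι)) := by
    ext (a | a) (b | b) <;> simp
  rw [h, Matrix.det_permute', Matrix.det_fromBlocks_zero₂₁]

end SkewDeterminant

/-! ### Zeros of multi-affine real polynomials -/

section MultiAffine

open MvPolynomial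

variable {E : Type*} [Fintype E]

/-- With degree at most one in the variable `e`, the first-order Taylor formula in that variable is
exact. -/
theorem eval_update_of_degree_le_one [DecidableEq E] (f : MvPolynomial E ℝ) (e : E)
    (hf : ∀ d ∈ f.support, d e ≤ 1) (x : E → ℝ) (t : ℝ) :
    eval (Function.update x e t) f = eval x f + (t - x e) * eval x (pderiv e f) := by
  conv_lhs => rw [← f.support_sum_monomial_coeff]
  conv_rhs => rw [← f.support_sum_monomial_coeff]
  simp only [map_sum, Finset.mul_sum, ← Finset.sum_add_distrib]
  refine Finset.sum_congr rfl fun d hd => ?_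
  have hprod (y : E → ℝ) : d.prod (fun i k => y i ^ k) =
      y e ^ d e * ∏ i ∈ Finset.univ.erase e, y i ^ d i := by
    rw [Finsupp.prod_fintype _ _ (by simp), 
      Finset.mul_prod_erase Finset.univ (fun i => y i ^ d i) (Finset.mem_univ e)]
  have hrest : ∏ i ∈ Finset.univ.erase e, Function.update x e t i ^ d i =
      ∏ i ∈ Finset.univ.erase e, x i ^ d i :=
    Finset.prod_congr rfl fun i hi => by
      rw [Function.update_of_ne (Finset.ne_of_mem_erase hi)]
  rw [pderiv_monomial]
  simp only [eval_monomial, hprod, hrest, Function.update_self]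
  rcases Nat.le_one_iff_eq_zero_or_eq_one.mp (hf d hd) with h | h
  · simp [h]
  · have hsub : (d - Finsupp.single e 1).prod (fun i k => x i ^ k) =
        ∏ i ∈ Finset.univ.erase e, x i ^ d i := by
      rw [Finsupp.prod_fintype _ _ (by simp), ← Finset.mul_prod_erase Finset.univ (fun i => x i ^ (d - Finsupp.single e 1 : E →₀ ℕ) i)
          (Finset.mem_univ e)]
      simp only [Finsupp.coe_tsub, Pi.sub_apply, Finsupp.single_eq_same, h, Nat.sub_self,
        pow_zero, one_mul]
      refine Finset.prod_congr rfl fun i hi => ?_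
      rw [Finsupp.single_eq_of_ne (Finset.ne_of_mem_erase hi), Nat.sub_zero]
    rw [hsub, h]
    push_cast
    ring

/-- Euler's identity for a polynomial all of whose monomials have weighted degree one. -/
theorem sum_mul_eval_pderiv_of_weighted_degree_one (f : MvPolynomial E ℝ) (k : E → ℕ)
    (hf : ∀ d ∈ f.support, ∑ e, d e * k e = 1) (x : E → ℝ) :
    ∑ e, (k e : ℝ) * (x e * eval x (pderiv e f)) = eval x f := by
  have key : ∑ e, C (k e : ℝ) * (X e * pderiv e f) = f := by
    conv_lhs => rw [← f.support_sum_monomial_coeff]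
    conv_rhs => rw [← f.support_sum_monomial_coeff]
    simp only [map_sum, Finset.mul_sum]
    rw [Finset.sum_comm]
    refine Finset.sum_congr rfl fun d hd => ?_
    have h (e : E) : C (k e : ℝ) * (X e * pderiv e (monomial d (coeff d f))) =
        monomial d (coeff d f * ((d e * k e : ℕ) : ℝ)) := by
      rw [X_mul_pderiv_monomial, ← map_nsmul, C_mul_monomial]
      congr 1
      push_cast
      rw [nsmul_eq_mul]
      ring
    simp only [h]
    rw [← map_sum, ← Finset.mul_sum, ← Nat.cast_sum, hf d hd]
    simp
  conv_rhs => rw [← key]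
  simp

/-- Substituting a fraction with denominator `β` for one variable of a polynomial gives, up to
a power of `β`, a polynomial. -/
theorem exists_eval_eq_pow_mul_eval_update {E : Type*} [DecidableEq E] (f β g : MvPolynomial E ℝ) (e : E) :
    ∃ (N : ℕ) (G : MvPolynomial E ℝ), ∀ x, eval x β ≠ 0 →
      eval x G = eval x β ^ N * eval (Function.update x e (x e - eval x f / eval x β)) g := by
  induction g using MvPolynomial.induction_on with
  | C a => exact ⟨0, C a, by simp⟩
  | add p q hp hq =>
    obtain ⟨N, G, hG⟩ := hp
    obtain ⟨N', G', hG'⟩ := hq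
    refine ⟨N + N', β ^ N' * G + β ^ N * G', fun x hx => ?_⟩
    simp only [map_add, map_mul, map_pow, hG x hx, hG' x hx]
    ring
  | mul_X p i hp =>
    obtain ⟨N, G, hG⟩ := hp
    by_cases h : i = e
    · subst h
      refine ⟨N + 1, G * (β * X i - f), fun x hx => ?_⟩
      simp only [map_mul, map_sub, hG x hx, eval_X, Function.update_self]
      field_simp
      ring
    · refine ⟨N, G * X i, fun x hx => ?_⟩
      simp only [map_mul, hG x hx, eval_X, Function.update_of_ne h]
      ring

/-- A ball of the sup metric is a product of intervals, and a polynomial vanishing on a product of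
infinite sets is zero. -/
theorem MvPolynomial.eq_zero_of_eventually_eval_eq_zero (f : MvPolynomial E ℝ) (x : E → ℝ)
    (h : ∀ᶠ y in nhds x, eval y f = 0) : f = 0 := by
  obtain ⟨ε, hε, hball⟩ := Metric.eventually_nhds_iff_ball.mp h
  refine funext_set (fun i => Metric.ball (x i) ε) (fun i => ?_) fun y hy => ?_
  · rw [Real.ball_eq_Ioo]
    exact Set.Ioo_infinite (by linarith)
  · rw [map_zero]
    exact hball y (by rwa [ball_pi _ hε])

theorem MvPolynomial.exists_mem_eval_ne_zero {f : MvPolynomial E ℝ} (hf : f ≠ 0) {x : E → ℝ}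
    {U : Set (E → ℝ)} (hU : U ∈ nhds x) : ∃ y ∈ U, eval y f ≠ 0 := by
  by_contra! h
  exact hf (eq_zero_of_eventually_eval_eq_zero f x (Filter.mem_of_superset hU h))

theorem isOpen_setOf_forall_pos : IsOpen {x : E → ℝ | ∀ e, 0 < x e} := by
  simp only [Set.ofPred_forall]
  exact isOpen_iInter_of_finite fun e => isOpen_lt continuous_const (continuous_apply e)

/-- Near each zero of a nonzero multi-affine polynomial there is a regular zero. -/
theorem exists_eval_eq_zero_pderiv_ne_zero [DecidableEq E] (f : MvPolynomial E ℝ) (hf0 : f ≠ 0)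
    (hf : ∀ d ∈ f.support, ∀ e, d e ≤ 1) {x : E → ℝ} (hx : eval x f = 0)
    {U : Set (E → ℝ)} (hU : U ∈ nhds x) :
    ∃ y ∈ U, eval y f = 0 ∧ ∃ e, eval y (pderiv e f) ≠ 0 := by
  obtain ⟨ε, hε, hball⟩ := Metric.mem_nhds_iff.mp hU
  obtain ⟨q, hq, hfq⟩ := exists_mem_eval_ne_zero hf0 (Metric.ball_mem_nhds x hε)
  have hmem (s : Finset E) : s.piecewise q x ∈ Metric.ball x ε := by
    rw [ball_pi _ hε] at hq ⊢
    intro e he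
    by_cases h : e ∈ s
    · simpa [h] using hq e he
    · simpa [h] using hε
  by_contra! hcon
  -- If all partial derivatives vanished at all zeros in the ball, the coordinates of `x` could be
  -- replaced one by one by those of `q` with `f` staying zero, although `f` is nonzero at `q`.
  have hzero (s : Finset E) : eval (s.piecewise q x) f = 0 := by
    induction s using Finset.induction_on with
    | empty => simpa using hx
    | insert e s _ ih =>
      rw [Finset.piecewise_insert, eval_update_of_degree_le_one f e (fun d hd => hf d hd e), ih,
        hcon _ (hball (hmem s)) ih e]
      simp
  exact hfq (by simpa using hzero Finset.univ)

/-- A polynomial `g` is nonzero at a dense set of positive zeros of a multi-affine polynomial `f`,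
provided that regular zeros are regular for a variable of a set `good`, and that for each of these
variables there is some real zero of `f`, regular for this variable, at which `g` is nonzero. -/
theorem zeros_subset_closure_eval_ne_zero [DecidableEq E] (f g : MvPolynomial E ℝ) (good : Set E) (hf0 : f ≠ 0)
    (hf : ∀ d ∈ f.support, ∀ e, d e ≤ 1)
    (hgood : ∀ x : E → ℝ, (∀ e, 0 < x e) → eval x f = 0 →
      (∃ e, eval x (pderiv e f) ≠ 0) → ∃ e ∈ good, eval x (pderiv e f) ≠ 0)
    (hstar : ∀ e ∈ good, ∃ x, eval x f = 0 ∧ eval x (pderiv e f) ≠ 0 ∧ eval x g ≠ 0) :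
    {x : E → ℝ | (∀ e, 0 < x e) ∧ eval x f = 0} ⊆
      closure {x | ((∀ e, 0 < x e) ∧ eval x f = 0) ∧ eval x g ≠ 0} := by
  rintro w ⟨hw, hfw⟩
  rw [mem_closure_iff]
  intro o ho hwo
  have hU : IsOpen (o ∩ {x : E → ℝ | ∀ e, 0 < x e}) := ho.inter isOpen_setOf_forall_pos
  obtain ⟨p, hpU, hfp, hreg⟩ :=
    exists_eval_eq_zero_pderiv_ne_zero f hf0 hf hfw (hU.mem_nhds ⟨hwo, hw⟩)
  obtain ⟨e, he, hβ⟩ := hgood p hpU.2 hfp hreg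
  obtain ⟨z, hfz, hβz, hgz⟩ := hstar e he
  set β := pderiv e f
  -- Since `f` is affine in `e` with slope `β`, solving for this coordinate moves `x` onto the zero
  -- set; zeros of `f` stay fixed.
  set Φ : (E → ℝ) → E → ℝ := fun x => Function.update x e (x e - eval x f / eval x β) with hΦ
  have hroot (x : E → ℝ) (hx : eval x β ≠ 0) : eval (Φ x) f = 0 := by
    rw [hΦ]
    simp only
    rw [eval_update_of_degree_le_one f e (fun d hd => hf d hd e)]
    change eval x f + _ * eval x β = 0
    field_simp
    ring
  have hfix (x : E → ℝ) (hx : eval x f = 0) : Φ x = x := by simp [hΦ, hx]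
  have hcont : ContinuousAt Φ p := by
    refine continuousAt_id.update e ?_
    exact (continuous_apply e).continuousAt.sub
      ((MvPolynomial.continuous_eval f).continuousAt.div
        (MvPolynomial.continuous_eval β).continuousAt hβ)
  have hΦU : ∀ᶠ x in nhds p, Φ x ∈ o ∩ {x : E → ℝ | ∀ e, 0 < x e} :=
    hcont.eventually_mem (by rw [hfix p hfp]; exact hU.mem_nhds hpU)
  have hβnhds : ∀ᶠ x in nhds p, eval x β ≠ 0 :=
    (MvPolynomial.continuous_eval β).continuousAt.eventually_ne hβ
  obtain ⟨N, G, hG⟩ := exists_eval_eq_pow_mul_eval_update f β g e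
  by_contra hemp
  -- `G` is `g ∘ Φ` cleared of denominators. If `g` vanished at all positive zeros in the open set,
  -- `G` would vanish near `p`, hence identically, and so also at `z`, which need be neither near
  -- `p` nor positive.
  have hG0 : G = 0 := by
    refine eq_zero_of_eventually_eval_eq_zero G p ?_
    filter_upwards [hΦU, hβnhds] with x hx hxβ
    rw [hG x hxβ, mul_eq_zero]
    right
    by_contra hgx
    exact hemp ⟨Φ x, hx.1, ⟨hx.2, hroot x hxβ⟩, hgx⟩
  have := hG z hβz
  rw [hG0, map_zero] at this
  change 0 = _ * eval (Φ z) g at this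
  rw [hfix z hfz] at this
  exact mul_ne_zero (pow_ne_zero N hβz) hgz this.symm

end MultiAffine

/-! ### The symmetry of `P` and its derivatives at `1` -/

namespace FisherCylinder

variable {m n : ℕ}

theorem card_vertex : Fintype.card (Vertex m n) = 6 * m * n := by
  simp only [Vertex, Fintype.card_prod, Fintype.card_fin]
  rw [show Fintype.card Side = 2 from rfl, show Fintype.card Corner = 3 from rfl]
  ring

theorem even_card_vertex : Even (Fintype.card (Vertex m n)) :=
  ⟨3 * m * n, by rw [card_vertex]; ring⟩

/-- Evaluation of complexified polynomials at real weights. -/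
noncomputable def evalWeights (w : Edge m n → ℝ) : MvPolynomial (Edge m n) ℝ →+* ℂ :=
  Complex.ofRealHom.comp (MvPolynomial.eval w)

theorem evalWeights_apply (w : Edge m n → ℝ) (Q : MvPolynomial (Edge m n) ℝ) :
    evalWeights w Q = (MvPolynomial.eval w Q : ℝ) := rfl

variable [NeZero n]

/-- The Kasteleyn matrix over any commutative ring, with independent factors `x` and `y` for the
two directions of the `z`-edges and a factor `t` for the other edges. -/
def kasteleyn {R : Type*} [CommRing R] (o : Edge m n → Bool) (w : Edge m n → R) (x y t : R) :
    Matrix (Vertex m n) (Vertex m n) R :=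
  fun u v => ∑ e : Edge m n,
    ((if tail o e = u ∧ head o e = v then w e * (if e.IsZEdge then x else t) else 0) -
      (if tail o e = v ∧ head o e = u then w e * (if e.IsZEdge then y else t) else 0))

theorem map_kasteleyn {R S : Type*} [CommRing R] [CommRing S] (φ : R →+* S)
    (o : Edge m n → Bool) (w : Edge m n → R) (x y t : R) :
    (kasteleyn o w x y t).map φ = kasteleyn o (fun e => φ (w e)) (φ x) (φ y) (φ t) := by
  ext u v
  simp only [kasteleyn, Matrix.map_apply, map_sum, map_sub, apply_ite φ, map_mul, map_zero]

theorem map_det_kasteleyn {R S : Type*} [CommRing R] [CommRing S] (φ : R →+* S)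
    (o : Edge m n → Bool) (w : Edge m n → R) (x y t : R) :
    φ (kasteleyn o w x y t).det = (kasteleyn o (fun e => φ (w e)) (φ x) (φ y) (φ t)).det := by
  rw [← map_kasteleyn, RingHom.map_det]
  rfl

theorem K_eq_kasteleyn (o : Edge m n → Bool) (w : Edge m n → ℝ) (z : ℂ) :
    K o w z = kasteleyn o (fun e => (w e : ℂ)) z z⁻¹ 1 := by
  ext u v
  simp only [K, kasteleyn, zFactor, apply_ite Inv.inv, inv_one]

theorem smul_kasteleyn {R : Type*} [CommRing R] (a : R) (o : Edge m n → Bool) (w : Edge m n → R)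
    (x y t : R) :
    a • kasteleyn o w x y t = kasteleyn o w (a * x) (a * y) (a * t) := by
  ext u v
  simp only [kasteleyn, Matrix.smul_apply, smul_eq_mul, Finset.mul_sum, mul_sub, mul_ite, mul_zero]
  refine Finset.sum_congr rfl fun e _ => ?_
  congr 1 <;> split_ifs <;> ring

theorem transpose_kasteleyn {R : Type*} [CommRing R] (o : Edge m n → Bool) (w : Edge m n → R)
    (x y t : R) : (kasteleyn o w x y t).transpose = -kasteleyn o w y x t := by
  ext u v
  simp only [kasteleyn, Matrix.transpose_apply, Matrix.neg_apply, ← Finset.sum_neg_distrib,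
    neg_sub]

/-- Transposing exchanges `z` and `1/z` up to a global sign, which disappears because the size is
even. -/
theorem P_inv (o : Edge m n → Bool) (w : Edge m n → ℝ) (z : ℂ) : P o w z⁻¹ = P o w z := by
  simp only [P, K_eq_kasteleyn, inv_inv]
  rw [← Matrix.det_transpose, transpose_kasteleyn, Matrix.det_neg, even_card_vertex.neg_one_pow,
    one_mul]

/-- The determinant of `z K(z)`, as a polynomial in `z` with coefficients in the ring of
polynomials in the edge weights. -/
noncomputable def charPoly (o : Edge m n → Bool) : Polynomial (MvPolynomial (Edge m n) ℝ) :=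
  -- Multiplying by `z` turns the factors `z`, `1/z`, `1` into `z²`, `1`, `z`, so no denominators
  -- remain.
  (kasteleyn o (fun e => Polynomial.C (MvPolynomial.X e : MvPolynomial (Edge m n) ℝ)) (Polynomial.X ^ 2) 1 Polynomial.X).det

theorem eval_map_charPoly (o : Edge m n → Bool) (w : Edge m n → ℝ) {z : ℂ} (hz : z ≠ 0) :
    ((charPoly o).map (evalWeights w)).eval z = z ^ Fintype.card (Vertex m n) * P o w z := by
  rw [Polynomial.eval_map, ← Polynomial.coe_eval₂RingHom, charPoly, map_det_kasteleyn, P,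
    K_eq_kasteleyn, ← Matrix.det_smul, smul_kasteleyn, mul_inv_cancel₀ hz, mul_one, ← sq]
  simp [evalWeights_apply]

theorem P_eq_eval_mul_zpow (o : Edge m n → Bool) (w : Edge m n → ℝ) {z : ℂ} (hz : z ≠ 0) :
    P o w z =
      ((charPoly o).map (evalWeights w)).eval z * z ^ (-(Fintype.card (Vertex m n) : ℤ)) := by
  rw [eval_map_charPoly o w hz, zpow_neg, zpow_natCast]
  field_simp

/-- The second derivative of `P` at `1`, as a polynomial in the edge weights. -/
noncomputable def secondDerivPoly (o : Edge m n → Bool) : MvPolynomial (Edge m n) ℝ :=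
  -- With `N` vertices, `P = q z⁻ᴺ` for `q` the specialised `charPoly`, so `P''(1) = q'' - 2N q' +
  -- N(N+1) q` at `1`.
  (charPoly o).derivative.derivative.eval 1 -
    2 * (Fintype.card (Vertex m n) : MvPolynomial (Edge m n) ℝ) * (charPoly o).derivative.eval 1 +
    (Fintype.card (Vertex m n) : MvPolynomial (Edge m n) ℝ) *
      (Fintype.card (Vertex m n) + 1) * (charPoly o).eval 1

theorem hasDerivAt_eval_mul_zpow (q : Polynomial ℂ) (a : ℤ) {z : ℂ} (hz : z ≠ 0) :
    HasDerivAt (fun z => q.eval z * z ^ a)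
      (q.derivative.eval z * z ^ a + q.eval z * (a * z ^ (a - 1))) z :=
  (q.hasDerivAt z).mul (hasDerivAt_zpow a z (Or.inl hz))

theorem hasDerivAt_P (o : Edge m n → Bool) (w : Edge m n → ℝ) {z : ℂ} (hz : z ≠ 0) :
    HasDerivAt (P o w) (deriv (P o w) z) z := by
  refine DifferentiableAt.hasDerivAt ?_
  refine (hasDerivAt_eval_mul_zpow ((charPoly o).map (evalWeights w))
    (-(Fintype.card (Vertex m n) : ℤ)) hz).differentiableAt.congr_of_eventuallyEq ?_
  filter_upwards [isOpen_ne.mem_nhds hz] with u hu using P_eq_eval_mul_zpow o w hu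

theorem deriv_P_eq (o : Edge m n → Bool) (w : Edge m n → ℝ) {z : ℂ} (hz : z ≠ 0) :
    deriv (P o w) z =
      ((charPoly o).map (evalWeights w)).derivative.eval z *
          z ^ (-(Fintype.card (Vertex m n) : ℤ)) +
        ((charPoly o).map (evalWeights w)).eval z * ((-(Fintype.card (Vertex m n) : ℤ) : ℤ) *
          z ^ (-(Fintype.card (Vertex m n) : ℤ) - 1)) := by
  rw [← (hasDerivAt_eval_mul_zpow ((charPoly o).map (evalWeights w))
    (-(Fintype.card (Vertex m n) : ℤ)) hz).deriv]
  refine Filter.EventuallyEq.deriv_eq ?_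
  filter_upwards [isOpen_ne.mem_nhds hz] with u hu using P_eq_eval_mul_zpow o w hu

theorem hasDerivAt_deriv_P (o : Edge m n → Bool) (w : Edge m n → ℝ) :
    HasDerivAt (deriv (P o w)) (MvPolynomial.eval w (secondDerivPoly o) : ℝ) 1 := by
  have h1 := hasDerivAt_eval_mul_zpow ((charPoly o).map (evalWeights w)).derivative
    (-(Fintype.card (Vertex m n) : ℤ)) (one_ne_zero (α := ℂ))
  have h2 := ((hasDerivAt_eval_mul_zpow ((charPoly o).map (evalWeights w))
    (-(Fintype.card (Vertex m n) : ℤ) - 1) (one_ne_zero (α := ℂ))).const_mul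
      ((-(Fintype.card (Vertex m n) : ℤ) : ℤ) : ℂ))
  refine ((h1.add h2).congr_of_eventuallyEq ?_).congr_deriv ?_
  · filter_upwards [isOpen_ne.mem_nhds (one_ne_zero (α := ℂ))] with u hu
    rw [deriv_P_eq o w hu, Pi.add_apply]
    ring
  · rw [← evalWeights_apply, secondDerivPoly]
    simp only [map_add, map_sub, map_mul, map_natCast, map_ofNat, map_one,
      Polynomial.derivative_map, Polynomial.eval_one_map, one_zpow]
    push_cast
    ring

theorem deriv_P_one (o : Edge m n → Bool) (w : Edge m n → ℝ) : deriv (P o w) 1 = 0 := by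
  have h1 := hasDerivAt_P o w (one_ne_zero (α := ℂ))
  have h2 : HasDerivAt (fun z : ℂ => P o w z⁻¹) (deriv (P o w) 1 * -(1 ^ 2)⁻¹) 1 := by
    have h1' : HasDerivAt (P o w) (deriv (P o w) 1) ((1 : ℂ)⁻¹) := by simpa using h1
    exact h1'.comp 1 (hasDerivAt_inv one_ne_zero)
  simp only [P_inv] at h2
  have := h1.unique h2
  rw [one_pow, inv_one, mul_neg_one] at this
  exact self_eq_neg.mp this

theorem iteratedDeriv_two_P (o : Edge m n → Bool) (w : Edge m n → ℝ) :
    iteratedDeriv 2 (P o w) 1 = (MvPolynomial.eval w (secondDerivPoly o) : ℝ) := by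
  rw [iteratedDeriv_succ, iteratedDeriv_one]
  exact (hasDerivAt_deriv_P o w).deriv

theorem hasDerivAt_exp_mul_I (θ : ℝ) :
    HasDerivAt (fun θ : ℝ => Complex.exp (θ * Complex.I))
      (Complex.exp (θ * Complex.I) * Complex.I) θ := by
  have h : HasDerivAt (fun z : ℂ => Complex.exp (z * Complex.I))
      (Complex.exp (θ * Complex.I) * (1 * Complex.I)) θ :=
    ((hasDerivAt_id (θ : ℂ)).mul_const Complex.I).cexp
  simpa using h.comp_ofReal

theorem hasDerivAt_PAngle (o : Edge m n → Bool) (w : Edge m n → ℝ) (θ : ℝ) :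
    HasDerivAt (PAngle o w) (deriv (P o w) (Complex.exp (θ * Complex.I)) *
      (Complex.exp (θ * Complex.I) * Complex.I)) θ :=
  (hasDerivAt_P o w (Complex.exp_ne_zero _)).comp θ (hasDerivAt_exp_mul_I θ)

/-- The chain rule gives `P''(1) · I²` plus a multiple of `P'(1)`, which is zero. -/
theorem iteratedDeriv_two_PAngle (o : Edge m n → Bool) (w : Edge m n → ℝ) :
    iteratedDeriv 2 (PAngle o w) 0 = -(MvPolynomial.eval w (secondDerivPoly o) : ℝ) := by
  rw [iteratedDeriv_succ, iteratedDeriv_one, funext fun θ => (hasDerivAt_PAngle o w θ).deriv]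
  have h1 : HasDerivAt (deriv (P o w)) (MvPolynomial.eval w (secondDerivPoly o) : ℝ)
      (Complex.exp ((0 : ℝ) * Complex.I)) := by
    simpa using hasDerivAt_deriv_P o w
  have h2 := (h1.comp (0 : ℝ) (hasDerivAt_exp_mul_I 0)).mul
    ((hasDerivAt_exp_mul_I 0).mul_const Complex.I)
  refine h2.deriv.trans ?_
  simp [deriv_P_one, mul_assoc]

theorem analyticAt_P_one (o : Edge m n → Bool) (w : Edge m n → ℝ) : AnalyticAt ℂ (P o w) 1 := by
  rw [Complex.analyticAt_iff_eventually_differentiableAt]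
  filter_upwards [isOpen_ne.mem_nhds (one_ne_zero (α := ℂ))] with u hu
  exact (hasDerivAt_P o w hu).differentiableAt

theorem analyticOrderAt_P_one (o : Edge m n → Bool) (w : Edge m n → ℝ) (h0 : P o w 1 = 0)
    (h2 : MvPolynomial.eval w (secondDerivPoly o) ≠ 0) : analyticOrderAt (P o w) 1 = 2 := by
  refine (analyticOrderAt_eq_nat_iff_iteratedDeriv_eq_zero (analyticAt_P_one o w) (n := 2)).mpr
    ⟨fun i hi => ?_, ?_⟩
  · interval_cases i
    · simpa using h0
    · simpa using deriv_P_one o w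
  · rw [iteratedDeriv_two_P]
    exact_mod_cast h2

/-! ### The square root of `det K(1)` and its degrees at the vertices -/

/-- The determinant of `K(1)`, as a polynomial in the edge weights. -/
noncomputable def detPoly (o : Edge m n → Bool) : MvPolynomial (Edge m n) ℝ :=
  (kasteleyn o MvPolynomial.X 1 1 1).det

theorem P_one_eq_eval_detPoly (o : Edge m n → Bool) (w : Edge m n → ℝ) :
    P o w 1 = (MvPolynomial.eval w (detPoly o) : ℝ) := by
  rw [← evalWeights_apply, detPoly, map_det_kasteleyn, P, K_eq_kasteleyn]
  simp [evalWeights_apply]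

theorem isSquare_detPoly (o : Edge m n → Bool) : IsSquare (detPoly o) :=
  isSquare_det_of_transpose_eq_neg _ (transpose_kasteleyn _ _ _ _ _)

/-- Gauge invariance: rescaling all edges at a vertex rescales one row and one column. This is what
detects the degree of monomials at a vertex. -/
theorem kasteleyn_gauge {R : Type*} [CommRing R] (d : Vertex m n → R) (o : Edge m n → Bool)
    (w : Edge m n → R) (x y t : R) :
    kasteleyn o (fun e => d e.fst * d e.snd * w e) x y t =
      Matrix.diagonal d * kasteleyn o w x y t * Matrix.diagonal d := by
  ext u v
  rw [Matrix.mul_diagonal, Matrix.diagonal_mul]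
  simp only [kasteleyn, Finset.mul_sum, Finset.sum_mul]
  refine Finset.sum_congr rfl fun e _ => ?_
  have hd : d e.fst * d e.snd = d (tail o e) * d (head o e) := by
    unfold tail head
    split_ifs
    · rfl
    · exact mul_comm _ _
  rw [hd, mul_sub, sub_mul]
  congr 1
  · by_cases h : tail o e = u ∧ head o e = v
    · rw [if_pos h, if_pos h, h.1, h.2]; ring
    · rw [if_neg h, if_neg h]; ring
  · by_cases h : tail o e = v ∧ head o e = u
    · rw [if_pos h, if_pos h, h.1, h.2]; ring
    · rw [if_neg h, if_neg h]; ring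

/-- The number of ends of the edge `e` at the vertex `u`. -/
def incidence (u : Vertex m n) (e : Edge m n) : ℕ :=
  (if e.fst = u then 1 else 0) + (if e.snd = u then 1 else 0)

theorem _root_.MvPolynomial.coeff_aeval_C_mul_X {E R : Type*} [CommRing R] (a : E → R)
    (f : MvPolynomial E R) (d : E →₀ ℕ) :
    MvPolynomial.coeff d
        (MvPolynomial.aeval (fun e => MvPolynomial.C (a e) * MvPolynomial.X e) f :
          MvPolynomial E R) =
      d.prod (fun e k => a e ^ k) * MvPolynomial.coeff d f := by
  classical
  induction f using MvPolynomial.induction_on' with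
  | monomial c r =>
    rw [MvPolynomial.aeval_monomial]
    simp only [mul_pow, Finsupp.prod_mul, ← map_pow]
    have h1 : (c.prod fun e k => MvPolynomial.C (σ := E) (a e ^ k)) =
        MvPolynomial.C (c.prod fun e k => a e ^ k) := (map_finsuppProd _ _ _).symm
    rw [h1, MvPolynomial.algebraMap_eq, ← mul_assoc, ← map_mul, ← MvPolynomial.monomial_eq,
      MvPolynomial.coeff_monomial, MvPolynomial.coeff_monomial]
    split_ifs with h
    · rw [h, mul_comm]
    · simp
  | add p q hp hq => rw [map_add, MvPolynomial.coeff_add, MvPolynomial.coeff_add, hp, hq, mul_add]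

theorem aeval_gauge_detPoly (o : Edge m n → Bool) (u : Vertex m n) :
    MvPolynomial.aeval (fun e => MvPolynomial.C ((2 : ℝ) ^ incidence u e) * MvPolynomial.X e)
      (detPoly o) = 4 * detPoly o := by
  rw [detPoly, ← AlgHom.coe_toRingHom, map_det_kasteleyn]
  simp only [AlgHom.coe_toRingHom, MvPolynomial.aeval_X, map_one]
  have h : (fun e => MvPolynomial.C ((2 : ℝ) ^ incidence u e) * MvPolynomial.X e) =
      fun e : Edge m n => (if e.fst = u then 2 else 1) * (if e.snd = u then 2 else 1) *
        (MvPolynomial.X e : MvPolynomial (Edge m n) ℝ) := by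
    funext e
    unfold incidence
    congr 1
    split_ifs <;> norm_num <;> exact map_ofNat MvPolynomial.C _
  rw [h, kasteleyn_gauge (fun v => if v = u then 2 else 1), Matrix.det_mul, Matrix.det_mul,
    Matrix.det_diagonal, Finset.prod_ite_eq' Finset.univ u, if_pos (Finset.mem_univ u)]
  ring

/-- In a square root of `det K(1)` each monomial has degree one at each vertex. -/
theorem sum_mul_incidence_eq_one {o : Edge m n → Bool} {f : MvPolynomial (Edge m n) ℝ}
    (hf : detPoly o = f * f) {d : Edge m n →₀ ℕ} (hd : d ∈ f.support) (u : Vertex m n) :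
    ∑ e, d e * incidence u e = 1 := by
  have h := aeval_gauge_detPoly o u
  rw [hf, map_mul, show (4 : MvPolynomial (Edge m n) ℝ) * (f * f) =
    (MvPolynomial.C 2 * f) * (MvPolynomial.C 2 * f) by rw [map_ofNat]; ring] at h
  have hc : MvPolynomial.coeff d f ≠ 0 := MvPolynomial.mem_support_iff.mp hd
  have hpow : d.prod (fun e k => ((2 : ℝ) ^ incidence u e) ^ k) =
      2 ^ ∑ e, d e * incidence u e := by
    rw [Finsupp.prod_fintype _ _ (by simp), ← Finset.prod_pow_eq_pow_sum]
    exact Finset.prod_congr rfl fun e _ => by rw [← pow_mul, mul_comm]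
  -- Doubling the weights at `u` multiplies `f²` by `4`, hence `f` by `2` or `-2`. A monomial is
  -- multiplied by `2` to its degree at `u`; this is positive, so it equals `2`.
  rcases mul_self_eq_mul_self_iff.mp h with h | h
  · have := congrArg (MvPolynomial.coeff d) h
    rw [MvPolynomial.coeff_aeval_C_mul_X, MvPolynomial.coeff_C_mul, hpow] at this
    have h2 : (2 : ℝ) ^ ∑ e, d e * incidence u e = 2 ^ 1 := by
      simpa using mul_right_cancel₀ hc this
    exact pow_right_injective₀ (by norm_num) (by norm_num) h2
  · have := congrArg (MvPolynomial.coeff d) h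
    rw [MvPolynomial.coeff_aeval_C_mul_X, MvPolynomial.coeff_neg, MvPolynomial.coeff_C_mul, hpow,
      ← neg_mul] at this
    have h2 := mul_right_cancel₀ hc this
    have : (0 : ℝ) < 2 ^ ∑ e, d e * incidence u e := by positivity
    linarith

theorem degree_le_one {o : Edge m n → Bool} {f : MvPolynomial (Edge m n) ℝ}
    (hf : detPoly o = f * f) {d : Edge m n →₀ ℕ} (hd : d ∈ f.support) (e : Edge m n) :
    d e ≤ 1 := by
  calc d e ≤ d e * incidence e.fst e := Nat.le_mul_of_pos_right _ (by simp [incidence])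
    _ ≤ ∑ e', d e' * incidence e.fst e' :=
      Finset.single_le_sum (f := fun e' => d e' * incidence e.fst e') (fun _ _ => Nat.zero_le _)
        (Finset.mem_univ e)
    _ = 1 := sum_mul_incidence_eq_one hf hd _

/-- The edges that lie on the cycle through all vertices of a row: all edges except for the
`c`-edges and the sides of the triangles that join the corners `a` and `b`. -/
def Edge.IsRowEdge : Edge m n → Prop
  | .tri _ _ _ .a => False
  | .c _ _ => False
  | _ => True

/-- The edges off the row cycles are pairwise disjoint, so an endpoint of `e` meets no other one:
corner `a` for a triangle side, corner `c` for a `c`-edge. -/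
theorem exists_incidence_of_not_isRowEdge {e : Edge m n} (he : ¬ e.IsRowEdge) :
    ∃ u, incidence u e ≠ 0 ∧ ∀ e' : Edge m n, ¬ e'.IsRowEdge → e' ≠ e → incidence u e' = 0 := by
  match e with
  | .a i j => exact absurd trivial he
  | .b i j => exact absurd trivial he
  | .tri i j s .b => exact absurd trivial he
  | .tri i j s .c => exact absurd trivial he
  | .tri i j s .a =>
    refine ⟨(i, j, s, .a), by simp [incidence, Edge.fst], fun e' he' hne => ?_⟩
    match e' with
    | .a i j => exact absurd trivial he'
    | .b i j => exact absurd trivial he'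
    | .tri i j s .b => exact absurd trivial he'
    | .tri i j s .c => exact absurd trivial he'
    | .tri i' j' s' .a =>
      simp only [incidence, Edge.fst, Edge.snd, Corner.next]
      simp_all
    | .c i' j' => simp [incidence, Edge.fst, Edge.snd]
  | .c i j =>
    refine ⟨(i.1, j, .right, .c), by simp [incidence, Edge.fst], fun e' he' hne => ?_⟩
    match e' with
    | .a i j => exact absurd trivial he'
    | .b i j => exact absurd trivial he'
    | .tri i j s .b => exact absurd trivial he'
    | .tri i j s .c => exact absurd trivial he'
    | .tri i' j' s' .a => simp [incidence, Edge.fst, Edge.snd, Corner.next]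
    | .c i' j' =>
      simp only [incidence, Edge.fst, Edge.snd]
      simp_all [Subtype.ext_iff]

/-- At a positive zero of a square root of `det K(1)` that is regular for some variable, some
variable for which it is regular belongs to an edge that lies on the cycle of a row. -/
theorem exists_isRowEdge_pderiv_ne_zero {o : Edge m n → Bool} {f : MvPolynomial (Edge m n) ℝ}
    (hf : detPoly o = f * f) {x : Edge m n → ℝ} (hx : ∀ e, 0 < x e)
    (hfx : MvPolynomial.eval x f = 0)
    (h : ∃ e, MvPolynomial.eval x (MvPolynomial.pderiv e f) ≠ 0) :
    ∃ e ∈ {e : Edge m n | e.IsRowEdge}, MvPolynomial.eval x (MvPolynomial.pderiv e f) ≠ 0 := by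
  obtain ⟨e, he⟩ := h
  by_contra! hcon
  have hrow : ¬ e.IsRowEdge := fun h => he (hcon e h)
  obtain ⟨u, hu, huniq⟩ := exists_incidence_of_not_isRowEdge hrow
  -- If the derivatives for all row edges vanished, Euler's identity at `u` would reduce to a
  -- nonzero multiple of `x e * ∂f/∂e` being `f(x) = 0`.
  have heuler := sum_mul_eval_pderiv_of_weighted_degree_one f (incidence u)
    (fun d hd => sum_mul_incidence_eq_one hf hd u) x
  rw [hfx, Finset.sum_eq_single e] at heuler
  · exact mul_ne_zero (Nat.cast_ne_zero.mpr hu) (mul_ne_zero (hx e).ne' he) heuler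
  · intro e' _ hne
    by_cases hr : e'.IsRowEdge
    · rw [hcon e' hr]; ring
    · rw [huniq e' hr hne]; simp
  · exact fun h => absurd (Finset.mem_univ e) h

end FisherCylinder

/-! ### The row cycles and their two-colouring -/

namespace FisherCylinder

variable {m n : ℕ}

/-- The pairs of vertices of a row cycle: each of the two colour classes of the cycles through
all vertices of the rows is indexed by this type. -/
abbrev Half (m n : ℕ) : Type := Fin m × Fin n × Fin 3

/-- The first colour class of the row cycles. -/
def evenVertex : Half m n → Vertex m n
  -- In each cell the cycle visits left `b`, `c`, `a`, then right `a`, `c`, `b`, and goes on to left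
  -- `b` of the next cell; the colours alternate.
  | (i, j, 0) => (i, j, .left, .b)
  | (i, j, 1) => (i, j, .left, .a)
  | (i, j, 2) => (i, j, .right, .c)

/-- The second colour class of the row cycles. -/
def oddVertex : Half m n → Vertex m n
  | (i, j, 0) => (i, j, .left, .c)
  | (i, j, 1) => (i, j, .right, .a)
  | (i, j, 2) => (i, j, .right, .b)

theorem evenVertex_injective : Function.Injective (evenVertex (m := m) (n := n)) := by
  rintro ⟨i, j, k⟩ ⟨i', j', k'⟩ h
  fin_cases k <;> fin_cases k' <;> simp_all [evenVertex]

theorem oddVertex_injective : Function.Injective (oddVertex (m := m) (n := n)) := by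
  rintro ⟨i, j, k⟩ ⟨i', j', k'⟩ h
  fin_cases k <;> fin_cases k' <;> simp_all [oddVertex]

theorem evenVertex_ne_oddVertex (h h' : Half m n) : evenVertex h ≠ oddVertex h' := by
  obtain ⟨i, j, k⟩ := h
  obtain ⟨i', j', k'⟩ := h'
  fin_cases k <;> fin_cases k' <;> simp [evenVertex, oddVertex]

/-- The two-colouring of the vertices. -/
noncomputable def colourEquiv : Half m n ⊕ Half m n ≃ Vertex m n :=
  Equiv.ofBijective (Sum.elim evenVertex oddVertex) <| by
    refine ⟨evenVertex_injective.sumElim oddVertex_injective evenVertex_ne_oddVertex, ?_⟩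
    rintro ⟨i, j, s, k⟩
    cases s <;> cases k
    · exact ⟨.inl (i, j, 1), rfl⟩
    · exact ⟨.inl (i, j, 0), rfl⟩
    · exact ⟨.inr (i, j, 0), rfl⟩
    · exact ⟨.inr (i, j, 1), rfl⟩
    · exact ⟨.inr (i, j, 2), rfl⟩
    · exact ⟨.inl (i, j, 2), rfl⟩

/-- The edges of the row cycles that match each vertex `evenVertex h` with `oddVertex h`. -/
def matchEdge : Half m n → Edge m n
  | (i, j, 0) => .tri i j .left .b
  | (i, j, 1) => .a i j
  | (i, j, 2) => .tri i j .right .b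

theorem matchEdge_injective : Function.Injective (matchEdge (m := m) (n := n)) := by
  rintro ⟨i, j, k⟩ ⟨i', j', k'⟩ h
  fin_cases k <;> fin_cases k' <;> simp_all [matchEdge]

variable [NeZero n]

/-- The other edges of the row cycles. -/
def linkEdge : Half m n → Edge m n
  | (i, j, 0) => .b i (j - 1)
  | (i, j, 1) => .tri i j .left .c
  | (i, j, 2) => .tri i j .right .c

/-- The cyclic permutation of the pairs of vertices of a row. -/
def rowShift : Equiv.Perm (Fin n × Fin 3) where
  toFun
    | (j, 0) => (j - 1, 2)
    | (j, 1) => (j, 0)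
    | (j, 2) => (j, 1)
  invFun
    | (j, 0) => (j, 1)
    | (j, 1) => (j, 2)
    | (j, 2) => (j + 1, 0)
  left_inv := by rintro ⟨j, k⟩; fin_cases k <;> simp
  right_inv := by rintro ⟨j, k⟩; fin_cases k <;> simp

theorem rowShift_ne (y : Fin n × Fin 3) : rowShift y ≠ y := by
  obtain ⟨j, k⟩ := y
  fin_cases k <;> simp [rowShift]

/-- `rowShift` is a single cycle: three steps lead from `(j, 0)` to `(j - 1, 0)`, passing through
the whole of column `j - 1`. -/
theorem mem_of_rowShift_invariant {S : Set (Fin n × Fin 3)}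
    (hS : ∀ y ∈ S, rowShift y ∈ S) {y : Fin n × Fin 3} (hy : y ∈ S) (y' : Fin n × Fin 3) :
    y' ∈ S := by
  have h2 (j : Fin n) (h : (j, 2) ∈ S) : (j, 1) ∈ S := by simpa [rowShift] using hS _ h
  have h1 (j : Fin n) (h : (j, 1) ∈ S) : (j, 0) ∈ S := by simpa [rowShift] using hS _ h
  have h0 (j : Fin n) (h : (j, 0) ∈ S) : (j - 1, 2) ∈ S := by simpa [rowShift] using hS _ h
  have hstart : (y.1, 0) ∈ S := by
    obtain ⟨j, k⟩ := y
    fin_cases k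
    · exact hy
    · exact h1 _ hy
    · exact h1 _ (h2 _ hy)
  have hall (k : ℕ) (d : Fin n) (hd : d.val = k) : (y.1 - d, 0) ∈ S := by
    induction k generalizing d with
    | zero =>
      have : d = 0 := Fin.ext (by simpa using hd)
      simpa [this] using hstart
    | succ k ih =>
      have hd0 : d ≠ 0 := by rintro rfl; simp at hd
      have hval : (d - 1).val = k := by
        rw [Fin.val_sub_one_of_ne_zero hd0, hd]; rfl
      have := h1 _ (h2 _ (h0 _ (ih (d - 1) hval)))
      rwa [show y.1 - (d - 1) - 1 = y.1 - d by abel] at this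
  obtain ⟨j, k⟩ := y'
  have hj2 : (j, 2) ∈ S := by
    have := h0 _ (hall _ (y.1 - (j + 1)) rfl)
    rwa [show y.1 - (y.1 - (j + 1)) - 1 = j by abel] at this
  fin_cases k
  · exact h1 _ (h2 _ hj2)
  · exact h2 _ hj2
  · exact hj2

/-- The cyclic permutation of the pairs of vertices of the row `i`. -/
def shiftRow (i : Fin m) : Equiv.Perm (Half m n) := Equiv.Perm.prodExtendRight i rowShift

theorem shiftRow_apply (i : Fin m) (h : Half m n) :
    shiftRow i h = if h.1 = i then (h.1, rowShift h.2) else h := by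
  obtain ⟨i', y⟩ := h
  split_ifs with hi
  · simp only at hi
    subst hi
    exact Equiv.Perm.prodExtendRight_apply_eq _ _ _
  · exact Equiv.Perm.prodExtendRight_apply_ne _ hi _

theorem shiftRow_ne_one (i : Fin m) : shiftRow (n := n) i ≠ 1 := by
  intro h
  have := congrArg (fun σ : Equiv.Perm (Half m n) => σ (i, 0)) h
  simp only [shiftRow_apply, if_true, Equiv.Perm.one_apply, Prod.mk.injEq, true_and] at this
  exact rowShift_ne _ this

/-- By injectivity of `σ` the points of row `i` that it moves are closed under the shift, so they
are none or all. Hence only two terms of the Leibniz expansion survive. -/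
theorem eq_one_or_eq_shiftRow (i : Fin m) (σ : Equiv.Perm (Half m n))
    (hσ : ∀ h, σ h = h ∨ σ h = shiftRow i h) : σ = 1 ∨ σ = shiftRow i := by
  by_cases hex : ∃ y, σ (i, y) ≠ (i, y)
  · right
    obtain ⟨y, hy⟩ := hex
    have hval (y : Fin n × Fin 3) (hy : σ (i, y) ≠ (i, y)) : σ (i, y) = (i, rowShift y) := by
      simpa [shiftRow_apply] using (hσ (i, y)).resolve_left hy
    have hall := mem_of_rowShift_invariant (S := {y | σ (i, y) ≠ (i, y)}) (fun y hy h => by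
      have := σ.injective ((hval y hy).trans h.symm)
      exact rowShift_ne y (Prod.mk.inj this).2.symm) hy
    ext1 ⟨i', y'⟩
    by_cases hi : i' = i
    · subst hi
      rw [hval y' (hall y'), shiftRow_apply, if_pos rfl]
    · have := hσ (i', y')
      rw [shiftRow_apply, if_neg hi] at this ⊢
      exact this.elim id id
  · left
    push Not at hex
    ext1 ⟨i', y'⟩
    by_cases hi : i' = i
    · subst hi
      exact hex y'
    · have := hσ (i', y')
      rw [shiftRow_apply, if_neg hi] at this
      exact this.elim id id

/-- The weights `a` on the matching edges, `b` on the link edges and zero elsewhere. -/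
def rowWeight (a b : Half m n → ℝ) : Edge m n → ℝ
  | .tri i j .left .b => a (i, j, 0)
  | .a i j => a (i, j, 1)
  | .tri i j .right .b => a (i, j, 2)
  -- The link edge of `(i, j, 0)` comes from column `j - 1`, whence the shifted index.
  | .b i j => b (i, j + 1, 0)
  | .tri i j .left .c => b (i, j, 1)
  | .tri i j .right .c => b (i, j, 2)
  | .tri _ _ _ .a => 0
  | .c _ _ => 0

theorem rowWeight_matchEdge (a b : Half m n → ℝ) (h : Half m n) :
    rowWeight a b (matchEdge h) = a h := by
  obtain ⟨i, j, k⟩ := h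
  fin_cases k <;> rfl

theorem rowWeight_linkEdge (a b : Half m n → ℝ) (h : Half m n) :
    rowWeight a b (linkEdge h) = b h := by
  obtain ⟨i, j, k⟩ := h
  fin_cases k
  · simp [linkEdge, rowWeight]
  · rfl
  · rfl

theorem linkEdge_injective : Function.Injective (linkEdge (m := m) (n := n)) := by
  rintro ⟨i, j, k⟩ ⟨i', j', k'⟩ h
  fin_cases k <;> fin_cases k' <;> simp_all [linkEdge]

theorem matchEdge_ne_linkEdge (h h' : Half m n) : matchEdge h ≠ linkEdge h' := by
  obtain ⟨i, j, k⟩ := h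
  obtain ⟨i', j', k'⟩ := h'
  fin_cases k <;> fin_cases k' <;> simp [matchEdge, linkEdge]

theorem Edge.IsRowEdge.exists_eq {e : Edge m n} (he : e.IsRowEdge) :
    (∃ h, e = matchEdge h) ∨ ∃ h, e = linkEdge h := by
  match e with
  | .a i j => exact .inl ⟨(i, j, 1), rfl⟩
  | .b i j => exact .inr ⟨(i, j + 1, 0), by simp [linkEdge]⟩
  | .tri i j .left .b => exact .inl ⟨(i, j, 0), rfl⟩
  | .tri i j .right .b => exact .inl ⟨(i, j, 2), rfl⟩
  | .tri i j .left .c => exact .inr ⟨(i, j, 1), rfl⟩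
  | .tri i j .right .c => exact .inr ⟨(i, j, 2), rfl⟩
  | .tri i j s .a => exact he.elim
  | .c i j => exact he.elim

theorem rowWeight_of_not_isRowEdge (a b : Half m n → ℝ) {e : Edge m n} (he : ¬ e.IsRowEdge) :
    rowWeight a b e = 0 := by
  match e with
  | .a i j => exact absurd trivial he
  | .b i j => exact absurd trivial he
  | .tri i j .left .b => exact absurd trivial he
  | .tri i j .right .b => exact absurd trivial he
  | .tri i j .left .c => exact absurd trivial he
  | .tri i j .right .c => exact absurd trivial he
  | .tri i j .left .a => rfl
  | .tri i j .right .a => rfl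
  | .c i j => rfl

theorem sum_edge_eq {R : Type*} [AddCommMonoid R] (F : Edge m n → R)
    (hF : ∀ e, ¬ e.IsRowEdge → F e = 0) :
    ∑ e, F e = ∑ h, F (matchEdge h) + ∑ h, F (linkEdge h) := by
  refine Eq.trans ?_ (Fintype.sum_sum_type
    (fun s : Half m n ⊕ Half m n => F (Sum.elim matchEdge linkEdge s)))
  refine (Fintype.sum_of_injective (Sum.elim matchEdge linkEdge)
    (matchEdge_injective.sumElim linkEdge_injective matchEdge_ne_linkEdge) _ _ (fun e he => ?_)
    (fun _ => rfl)).symm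
  refine hF e fun hrow => he ?_
  rcases hrow.exists_eq with ⟨h, rfl⟩ | ⟨h, rfl⟩
  · exact ⟨.inl h, rfl⟩
  · exact ⟨.inr h, rfl⟩

end FisherCylinder

/-! ### The characteristic polynomial of a single row cycle -/

namespace FisherCylinder

variable {m n : ℕ}

theorem isZEdge_matchEdge (h : Half m n) : ¬ (matchEdge h).IsZEdge := by
  obtain ⟨i, j, k⟩ := h
  fin_cases k <;> exact id

variable [NeZero n]

/-- The edge `e` joins the vertex `evenVertex h` with the vertex `oddVertex h'`. -/
def Edge.Joins (e : Edge m n) (h h' : Half m n) : Prop :=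
  (e.fst = evenVertex h ∧ e.snd = oddVertex h') ∨ (e.fst = oddVertex h' ∧ e.snd = evenVertex h)

theorem matchEdge_joins (h : Half m n) : (matchEdge h).Joins h h := by
  obtain ⟨i, j, k⟩ := h
  fin_cases k
  · exact .inl ⟨rfl, rfl⟩
  · exact .inl ⟨rfl, rfl⟩
  · exact .inr ⟨rfl, rfl⟩

theorem linkEdge_joins (h : Half m n) : (linkEdge h).Joins h (h.1, rowShift h.2) := by
  obtain ⟨i, j, k⟩ := h
  fin_cases k
  · refine .inr ⟨?_, ?_⟩
    · simp [linkEdge, rowShift, Edge.fst, oddVertex]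
    · simp [linkEdge, Edge.snd, evenVertex]
  · refine .inr ⟨?_, ?_⟩
    · simp [linkEdge, rowShift, Edge.fst, oddVertex]
    · simp [linkEdge, Edge.snd, evenVertex, Corner.next]
  · refine .inl ⟨?_, ?_⟩
    · simp [linkEdge, Edge.fst, evenVertex]
    · simp [linkEdge, rowShift, Edge.snd, oddVertex, Corner.next]

theorem Edge.Joins.tail_head {e : Edge m n} {h h' : Half m n} (he : e.Joins h h')
    (o : Edge m n → Bool) :
    (tail o e = evenVertex h ∧ head o e = oddVertex h') ∨
      (tail o e = oddVertex h' ∧ head o e = evenVertex h) := by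
  unfold tail head
  rcases he with he | he <;> by_cases ho : o e <;> simp [ho, he]

open Classical in
/-- The sign that compensates for the orientation of an edge of a row cycle. -/
noncomputable def colourSign (o : Edge m n → Bool) (e : Edge m n) : ℝ :=
  if tail o e ∈ Set.range (evenVertex (m := m) (n := n)) then 1 else -1

open Classical in
/-- The factor of an edge of a row cycle, read from the first to the second colour class. -/
noncomputable def colourFactor (o : Edge m n → Bool) (z : ℂ) (e : Edge m n) : ℂ :=
  if tail o e ∈ Set.range (evenVertex (m := m) (n := n)) then zFactor z e else (zFactor z e)⁻¹

/-- The contribution of an edge to an entry of `K`. -/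
noncomputable def edgeTerm (o : Edge m n → Bool) (w : Edge m n → ℝ) (z : ℂ) (e : Edge m n)
    (u v : Vertex m n) : ℂ :=
  (if tail o e = u ∧ head o e = v then (w e : ℂ) * zFactor z e else 0) -
    (if tail o e = v ∧ head o e = u then (w e : ℂ) * (zFactor z e)⁻¹ else 0)

/-- `colourSign` cancels the orientation: read from even to odd the entry is `+c` times the colour
factor, and read backwards it is `-c` times the inverse factor. -/
theorem edgeTerm_cases (o : Edge m n → Bool) (c : Edge m n → ℝ) (z : ℂ) {e : Edge m n}
    {h h' : Half m n} (he : e.Joins h h') (x y : Half m n) :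
    edgeTerm o (fun e => colourSign o e * c e) z e (evenVertex x) (evenVertex y) = 0 ∧
    edgeTerm o (fun e => colourSign o e * c e) z e (oddVertex x) (oddVertex y) = 0 ∧
    edgeTerm o (fun e => colourSign o e * c e) z e (evenVertex x) (oddVertex y) =
      (if h = x ∧ h' = y then (c e : ℂ) * colourFactor o z e else 0) ∧
    edgeTerm o (fun e => colourSign o e * c e) z e (oddVertex y) (evenVertex x) =
      -(if h = x ∧ h' = y then (c e : ℂ) * (colourFactor o z e)⁻¹ else 0) := by
  have hne := evenVertex_ne_oddVertex (m := m) (n := n)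
  have hne' (h h' : Half m n) : oddVertex h ≠ evenVertex h' := (hne h' h).symm
  rcases he.tail_head o with ⟨h1, h2⟩ | ⟨h1, h2⟩
  · simp [edgeTerm, colourSign, colourFactor, h1, h2, hne, hne', evenVertex_injective.eq_iff,
      oddVertex_injective.eq_iff]
  · simp only [edgeTerm, colourSign, colourFactor, h1, h2, Set.mem_range, hne, hne',
      evenVertex_injective.eq_iff, oddVertex_injective.eq_iff, exists_false, if_false, and_false, false_and,
      sub_zero, and_comm (a := h' = y), inv_inv, true_and]
    constructor
    · split_ifs <;> simp
    · split_ifs <;> simp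

/-- The block of the Kasteleyn matrix of the row cycles that is indexed by the two colour
classes. -/
noncomputable def rowBlock (a b : Half m n → ℝ) (ζ : Half m n → ℂ) :
    Matrix (Half m n) (Half m n) ℂ :=
  fun x y => (if x = y then (a x : ℂ) else 0) +
    (if (x.1, rowShift x.2) = y then (b x : ℂ) * ζ x else 0)

theorem colourFactor_matchEdge (o : Edge m n → Bool) (z : ℂ) (h : Half m n) :
    colourFactor o z (matchEdge h) = 1 := by
  simp [colourFactor, zFactor, isZEdge_matchEdge]

theorem K_submatrix_colourEquiv (o : Edge m n → Bool) (a b : Half m n → ℝ) (z : ℂ) :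
    (K o (fun e => colourSign o e * rowWeight a b e) z).submatrix colourEquiv colourEquiv =
      Matrix.fromBlocks 0 (rowBlock a b fun h => colourFactor o z (linkEdge h))
        (-(rowBlock a b fun h => (colourFactor o z (linkEdge h))⁻¹).transpose) 0 := by
  set c := rowWeight a b with hc
  have hK (u v : Vertex m n) : K o (fun e => colourSign o e * c e) z u v =
      ∑ h, edgeTerm o (fun e => colourSign o e * c e) z (matchEdge h) u v +
        ∑ h, edgeTerm o (fun e => colourSign o e * c e) z (linkEdge h) u v := by
    refine sum_edge_eq (fun e => edgeTerm o (fun e => colourSign o e * c e) z e u v)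
      fun e he => ?_
    simp [edgeTerm, hc, rowWeight_of_not_isRowEdge a b he]
  have hm (h x y : Half m n) := edgeTerm_cases o c z (matchEdge_joins h) x y
  have hl (h x y : Half m n) := edgeTerm_cases o c z (linkEdge_joins h) x y
  have hcm (h : Half m n) : c (matchEdge h) = a h := rowWeight_matchEdge a b h
  have hcl (h : Half m n) : c (linkEdge h) = b h := rowWeight_linkEdge a b h
  have heven (x : Half m n) : colourEquiv (Sum.inl x) = evenVertex x := rfl
  have hodd (x : Half m n) : colourEquiv (Sum.inr x) = oddVertex x := rfl
  ext (x | x) (y | y)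
  · rw [Matrix.submatrix_apply, heven, heven, Matrix.fromBlocks_apply₁₁, Matrix.zero_apply, hK]
    simp only [(hm _ _ _).1, (hl _ _ _).1, Finset.sum_const_zero, add_zero]
  · rw [Matrix.submatrix_apply, heven, hodd, Matrix.fromBlocks_apply₁₂, hK]
    simp only [(hm _ _ _).2.2.1, (hl _ _ _).2.2.1, colourFactor_matchEdge, mul_one, ite_and,
      Finset.sum_ite_eq', Finset.mem_univ, if_true, rowBlock, hcm, hcl]
  · rw [Matrix.submatrix_apply, heven, hodd, Matrix.fromBlocks_apply₂₁, Matrix.neg_apply,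
      Matrix.transpose_apply, hK]
    simp only [(hm _ _ _).2.2.2, (hl _ _ _).2.2.2, colourFactor_matchEdge, mul_one, ite_and,
      Finset.sum_ite_eq', Finset.mem_univ, if_true, rowBlock, hcm, hcl, inv_one, Finset.sum_neg_distrib, neg_add]
  · rw [Matrix.submatrix_apply, hodd, hodd, Matrix.fromBlocks_apply₂₂, Matrix.zero_apply, hK]
    simp only [(hm _ _ _).2.1, (hl _ _ _).2.1, Finset.sum_const_zero, add_zero]

theorem det_rowBlock (a b : Half m n → ℝ) (ζ : Half m n → ℂ) (i : Fin m)
    (hb : ∀ h, h.1 ≠ i → b h = 0) :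
    (rowBlock a b ζ).det = ∏ h, (a h : ℂ) + ((Equiv.Perm.sign (shiftRow (n := n) i) : ℤ) : ℂ) *
      ∏ h : Half m n, if h.1 = i then (b h : ℂ) * ζ h else (a h : ℂ) := by
  have hne (x : Half m n) : (x.1, rowShift x.2) ≠ x := fun h =>
    rowShift_ne x.2 (congrArg Prod.snd h)
  rw [det_eq_prod_add_sign_mul_prod _ (shiftRow i) (shiftRow_ne_one i) _
    (eq_one_or_eq_shiftRow i)]
  · congr 1
    · exact Finset.prod_congr rfl fun x _ => by simp [rowBlock, hne]
    · congr 1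
      refine Finset.prod_congr rfl fun x _ => ?_
      rw [shiftRow_apply]
      split_ifs with hx
      · simp [rowBlock, (hne x).symm]
      · simp [rowBlock, hne]
  · intro x y hy1 hy2
    rw [shiftRow_apply] at hy2
    unfold rowBlock
    rw [if_neg hy1.symm, zero_add]
    by_cases hx : x.1 = i
    · rw [if_pos hx] at hy2
      rw [if_neg hy2.symm]
    · simp [hb x hx]

theorem isZEdge_linkEdge (h : Half m n) : (linkEdge h).IsZEdge ↔ h.2 = 0 := by
  obtain ⟨i, j, k⟩ := h
  fin_cases k
  · change (j - 1).val + 1 = n ↔ _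
    by_cases hj : j = 0
    · subst hj
      simp only [Fin.zero_eta, Prod.mk_zero_zero, iff_true]
      rw [Fin.val_sub, Fin.val_one', Fin.val_zero, add_zero]
      -- For `n = 1` the element `1` of `Fin n` has value `0`, so this case is separate.
      rcases Nat.lt_or_ge 1 n with hn | hn
      · rw [Nat.mod_eq_of_lt hn, Nat.mod_eq_of_lt (by omega)]
        omega
      · have : n = 1 := le_antisymm hn (NeZero.one_le)
        subst this
        rfl
    · have := Fin.val_sub_one_of_ne_zero hj
      have hlt := j.isLt
      have : j.val ≠ 0 := fun h => hj (Fin.ext (by simpa using h))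
      simp only [Fin.zero_eta, Prod.mk_eq_zero, hj, and_true, iff_false]
      omega
  · refine iff_of_false id ?_
    simp
  · refine iff_of_false id ?_
    simp

/-- The two off-diagonal blocks have determinants `A + Bζ` and `A + B/ζ` up to sign. The cycle of
row `i` has exactly one `z`-edge, so `ζ` is `z` or `1/z`, and the product is the same for both. -/
theorem P_colourSign_mul_rowWeight (o : Edge m n → Bool) (i : Fin m) :
    ∃ s : ℂ, s ≠ 0 ∧ ∀ a b : Half m n → ℝ, (∀ h, h.1 ≠ i → b h = 0) → ∀ (A B : ℝ),
      A = ∏ h, a h →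
      B = ((Equiv.Perm.sign (shiftRow (n := n) i) : ℤ) : ℝ) *
        ∏ h : Half m n, (if h.1 = i then b h else a h) →
      ∀ z, P o (fun e => colourSign o e * rowWeight a b e) z = s * ((A + B * z) * (A + B * z⁻¹)) := by
  refine ⟨((Equiv.Perm.sign (Equiv.sumComm (Half m n) (Half m n) :
      Equiv.Perm (Half m n ⊕ Half m n)) : ℤ) : ℂ) * (-1) ^ Fintype.card (Half m n), ?_, ?_⟩
  · refine mul_ne_zero (Int.cast_ne_zero.mpr (Units.ne_zero _)) (pow_ne_zero _ ?_)
    exact neg_ne_zero.mpr one_ne_zero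
  intro a b hb A B hA hB z
  have hdet (ζ : Half m n → ℂ) (hζ : ∀ h : Half m n, h.2 ≠ 0 → ζ h = 1) :
      (rowBlock a b ζ).det = A + B * ζ (i, 0) := by
    have hprod : ∏ h : Half m n, (if h.1 = i then (b h : ℂ) * ζ h else (a h : ℂ)) =
        (∏ h : Half m n, ((if h.1 = i then b h else a h : ℝ) : ℂ)) * ζ (i, 0) := by
      rw [← Finset.prod_ite_eq' Finset.univ ((i, 0) : Half m n) ζ |>.trans
        (if_pos (Finset.mem_univ _)), ← Finset.prod_mul_distrib]
      refine Finset.prod_congr rfl fun h _ => ?_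
      obtain ⟨i', y⟩ := h
      by_cases hi : i' = i
      · by_cases hy : y = 0
        · simp [hi, hy]
        · simp [hi, hy, hζ (i, y) hy]
      · simp [hi]
    rw [det_rowBlock a b ζ i hb, hprod, hA, hB]
    push_cast
    ring
  have hone (h : Half m n) (hh : h.2 ≠ 0) : colourFactor o z (linkEdge h) = 1 := by
    simp [colourFactor, zFactor, isZEdge_linkEdge, hh]
  have hz : colourFactor o z (linkEdge (i, 0)) = z ∨ colourFactor o z (linkEdge (i, 0)) = z⁻¹ := by
    unfold colourFactor
    rw [zFactor, if_pos ((isZEdge_linkEdge _).mpr rfl)]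
    split_ifs
    · exact .inl rfl
    · exact .inr rfl
  rw [P, ← Matrix.det_submatrix_equiv_self colourEquiv, K_submatrix_colourEquiv,
    det_fromBlocks_antidiagonal, Matrix.det_neg, Matrix.det_transpose, hdet _ hone,
    hdet _ (fun h hh => by rw [hone h hh, inv_one])]
  rcases hz with hz | hz
  · rw [hz]; ring
  · rw [hz, inv_inv]; ring

theorem iteratedDeriv_two_mul_inv (s : ℂ) :
    iteratedDeriv 2 (fun z : ℂ => s * ((1 + (-1) * z) * (1 + (-1) * z⁻¹))) 1 = -2 * s := by
  have h1 {z : ℂ} (hz : z ≠ 0) :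
      HasDerivAt (fun z : ℂ => s * ((1 + (-1) * z) * (1 + (-1) * z⁻¹)))
        (s * ((z ^ 2)⁻¹ - 1)) z := by
    have := ((((hasDerivAt_id z).const_mul (-1)).const_add 1).mul
      (((hasDerivAt_inv hz).const_mul (-1)).const_add 1)).const_mul s
    refine this.congr_deriv ?_
    simp only [id]
    field_simp
    ring
  have h2 : HasDerivAt (deriv fun z : ℂ => s * ((1 + (-1) * z) * (1 + (-1) * z⁻¹)))
      (-2 * s) 1 := by
    have := ((((hasDerivAt_id (1 : ℂ)).pow 2).inv (by simp)).sub_const 1).const_mul s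
    refine (this.congr_of_eventuallyEq ?_).congr_deriv ?_
    · filter_upwards [isOpen_ne.mem_nhds (one_ne_zero (α := ℂ))] with u hu
      simpa using (h1 hu).deriv
    · simp
      ring
  rw [iteratedDeriv_succ, iteratedDeriv_one]
  exact h2.deriv

/-- For each edge on the cycle of a row there are real weights that are critical, with nonzero
second derivative, and that cease to be critical when the weight of this edge is changed. -/
theorem exists_critical_weights (o : Edge m n → Bool) {e : Edge m n} (he : e.IsRowEdge) :
    ∃ w w' : Edge m n → ℝ, MvPolynomial.eval w (detPoly o) = 0 ∧
      MvPolynomial.eval w (secondDerivPoly o) ≠ 0 ∧ (∀ e', e' ≠ e → w' e' = w e') ∧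
      MvPolynomial.eval w' (detPoly o) ≠ 0 := by
  obtain ⟨i, hi⟩ : ∃ i : Fin m, ∀ h : Half m n, e = matchEdge h ∨ e = linkEdge h → h.1 = i := by
    rcases he.exists_eq with ⟨h, rfl⟩ | ⟨h, rfl⟩
    · refine ⟨h.1, fun h' hh => ?_⟩
      rcases hh with hh | hh
      · rw [matchEdge_injective hh]
      · exact absurd hh (matchEdge_ne_linkEdge _ _)
    · refine ⟨h.1, fun h' hh => ?_⟩
      rcases hh with hh | hh
      · exact absurd hh.symm (matchEdge_ne_linkEdge _ _)
      · rw [linkEdge_injective hh]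
  obtain ⟨s, hs, hP⟩ := P_colourSign_mul_rowWeight o i
  set ε : ℝ := ((Equiv.Perm.sign (shiftRow (n := n) i) : ℤ) : ℝ) with hε
  have hεε : ε * ε = 1 := by
    rw [hε, ← Int.cast_mul, ← Units.val_mul, Int.units_mul_self]
    simp
  -- The product of the link weights is `-ε`, which cancels the sign `ε` of the cycle and gives `B =
  -- -1`.
  set b : Half m n → ℝ := fun h => if h.1 = i then (if h = (i, 0) then -ε else 1) else 0 with hb
  have hb0 (h : Half m n) (hh : h.1 ≠ i) : b h = 0 := if_neg hh
  have hprodb : ∏ h : Half m n, (if h.1 = i then b h else 1) = -ε := by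
    rw [← Finset.prod_ite_eq' Finset.univ ((i, 0) : Half m n) (fun _ => -ε) |>.trans
      (if_pos (Finset.mem_univ _))]
    refine Finset.prod_congr rfl fun h _ => ?_
    by_cases hh : h.1 = i
    · simp [hb, hh]
    · have : h ≠ (i, 0) := fun h' => hh (by rw [h'])
      simp [hh, this]
  have hbase := hP (fun _ => 1) b hb0 1 (-1) (by simp) (by rw [hprodb]; linarith)
  refine ⟨fun e => colourSign o e * rowWeight (fun _ => 1) b e, ?_⟩
  have hzero : MvPolynomial.eval (fun e => colourSign o e * rowWeight (fun _ => 1) b e)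
      (detPoly o) = 0 := by
    have := P_one_eq_eval_detPoly o (fun e => colourSign o e * rowWeight (fun _ => 1) b e)
    rw [hbase] at this
    have h0 : (0 : ℂ) = ((MvPolynomial.eval
      (fun e => colourSign o e * rowWeight (fun _ => 1) b e) (detPoly o) : ℝ) : ℂ) := by
      rw [← this]; norm_num
    exact_mod_cast h0.symm
  have hsecond : MvPolynomial.eval (fun e => colourSign o e * rowWeight (fun _ => 1) b e)
      (secondDerivPoly o) ≠ 0 := by
    intro h0
    have := iteratedDeriv_two_P o (fun e => colourSign o e * rowWeight (fun _ => 1) b e)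
    rw [h0, funext hbase] at this
    push_cast at this
    rw [iteratedDeriv_two_mul_inv] at this
    exact mul_ne_zero (by norm_num) hs this
  have hone {w' : Edge m n → ℝ} (h : P o w' 1 ≠ 0) : MvPolynomial.eval w' (detPoly o) ≠ 0 := by
    intro h0
    rw [P_one_eq_eval_detPoly, h0] at h
    simp at h
  have hcongr (a' b' : Half m n → ℝ) (ha : ∀ h, matchEdge h ≠ e → a' h = 1)
      (hb' : ∀ h, linkEdge h ≠ e → b' h = b h) (e' : Edge m n) (hne : e' ≠ e) :
      colourSign o e' * rowWeight a' b' e' = colourSign o e' * rowWeight (fun _ => 1) b e' := by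
    congr 1
    by_cases hr : e'.IsRowEdge
    · rcases hr.exists_eq with ⟨h, rfl⟩ | ⟨h, rfl⟩
      · rw [rowWeight_matchEdge, rowWeight_matchEdge, ha h hne]
      · rw [rowWeight_linkEdge, rowWeight_linkEdge, hb' h hne]
    · rw [rowWeight_of_not_isRowEdge _ _ hr, rowWeight_of_not_isRowEdge _ _ hr]
  -- Doubling the weight of `e` gives `(A, B) = (2, -1)` for a matching edge and `(1, -2)` for a
  -- link edge, so `P(1) = s` in both cases.
  rcases he.exists_eq with ⟨h, rfl⟩ | ⟨h, rfl⟩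
  · refine ⟨fun e => colourSign o e * rowWeight (fun h' => if h' = h then 2 else 1) b e, hzero,
      hsecond, hcongr _ _ (fun h' hh => if_neg fun heq => hh (by rw [heq])) (fun _ _ => rfl),
      hone ?_⟩
    have hhi := hi h (.inl rfl)
    rw [hP _ b hb0 2 (-1) (by simp) ?_ 1]
    · refine mul_ne_zero hs ?_
      norm_num
    · have : ∏ h' : Half m n, (if h'.1 = i then b h' else if h' = h then 2 else 1) = -ε := by
        rw [← hprodb]
        refine Finset.prod_congr rfl fun h' _ => ?_
        by_cases hh : h'.1 = i
        · simp [hh]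
        · have : h' ≠ h := fun h'' => hh (by rw [h'', hhi])
          simp [hh, this]
      rw [this]
      linarith
  · refine ⟨fun e => colourSign o e *
        rowWeight (fun _ => 1) (fun h' => (if h' = h then 2 else 1) * b h') e, hzero,
      hsecond, hcongr _ _ (fun _ _ => rfl)
        (fun h' hh => by rw [if_neg fun heq => hh (by rw [heq]), one_mul]), hone ?_⟩
    have hhi := hi h (.inr rfl)
    rw [hP _ _ (fun h' hh => by rw [hb0 h' hh, mul_zero]) 1 (-2) (by simp) ?_ 1]
    · refine mul_ne_zero hs ?_
      norm_num
    · have : ∏ h' : Half m n, (if h'.1 = i then (if h' = h then 2 else 1) * b h' else 1) =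
          2 * -ε := by
        rw [← hprodb, ← Finset.prod_ite_eq' Finset.univ h (fun _ => (2 : ℝ)) |>.trans
          (if_pos (Finset.mem_univ _)), ← Finset.prod_mul_distrib]
        refine Finset.prod_congr rfl fun h' _ => ?_
        by_cases hh : h'.1 = i
        · simp [hh]
        · have : h' ≠ h := fun h'' => hh (by rw [h'', hhi])
          simp [hh, this]
      rw [this]
      linarith

end FisherCylinder

/-! ### Proof of the theorem -/

open FisherCylinder in
theorem mainTheorem11 (m n : ℕ) [NeZero m] [NeZero n]
    (o : FisherCylinder.Edge m n → Bool) (ho : FisherCylinder.ZAligned o) :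
    (∀ w ∈ FisherCylinder.positiveWeights m n, FisherCylinder.P o w 1 = 0 →
      HasDerivAt (FisherCylinder.P o w) 0 1 ∧
      HasDerivAt (FisherCylinder.PAngle o w) 0 0) ∧
    FisherCylinder.HoldsGenericallyOn (FisherCylinder.positiveWeights m n)
      (fun w => iteratedDeriv 2 (FisherCylinder.P o w) 1 ≠ 0 ∧
        iteratedDeriv 2 (FisherCylinder.PAngle o w) 0 ≠ 0) ∧
    FisherCylinder.HoldsGenericallyOn (FisherCylinder.criticalWeights o)
      (fun w => iteratedDeriv 2 (FisherCylinder.P o w) 1 ≠ 0 ∧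
        iteratedDeriv 2 (FisherCylinder.PAngle o w) 0 ≠ 0 ∧
        analyticOrderAt (FisherCylinder.P o w) 1 = 2) := by
  have h2 (w : Edge m n → ℝ) (hw : MvPolynomial.eval w (secondDerivPoly o) ≠ 0) :
      iteratedDeriv 2 (P o w) 1 ≠ 0 ∧ iteratedDeriv 2 (PAngle o w) 0 ≠ 0 := by
    rw [iteratedDeriv_two_P, iteratedDeriv_two_PAngle]
    exact ⟨by exact_mod_cast hw, neg_ne_zero.mpr (by exact_mod_cast hw)⟩
  have hedge : (Edge.a (0 : Fin m) (0 : Fin n)).IsRowEdge := trivial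
  obtain ⟨w₀, w₁, -, hw₀, -, hw₁⟩ := exists_critical_weights o hedge
  refine ⟨fun w _ _ => ⟨?_, ?_⟩, ⟨secondDerivPoly o, ?_, fun w _ hw => h2 w hw⟩,
    ⟨secondDerivPoly o, ?_, fun w hw hw2 =>
      ⟨(h2 w hw2).1, (h2 w hw2).2, analyticOrderAt_P_one o w hw.2 hw2⟩⟩⟩
  · have := hasDerivAt_P o w (one_ne_zero (α := ℂ))
    rwa [deriv_P_one] at this
  · refine (hasDerivAt_PAngle o w 0).congr_deriv ?_
    simp [deriv_P_one]
  · intro w hw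
    rw [mem_closure_iff]
    intro U hU hwU
    have hg : secondDerivPoly o ≠ 0 := by
      intro h
      rw [h, map_zero] at hw₀
      exact hw₀ rfl
    obtain ⟨y, hy, hgy⟩ := MvPolynomial.exists_mem_eval_ne_zero hg
      ((hU.inter isOpen_setOf_forall_pos).mem_nhds ⟨hwU, hw⟩)
    exact ⟨y, hy.1, hy.2, hgy⟩
  · obtain ⟨f, hf⟩ := isSquare_detPoly o
    have hzero (x : Edge m n → ℝ) : MvPolynomial.eval x f = 0 ↔
        MvPolynomial.eval x (detPoly o) = 0 := by
      rw [hf, map_mul, mul_self_eq_zero]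
    have hcrit (x : Edge m n → ℝ) : x ∈ criticalWeights o ↔
        (∀ e, 0 < x e) ∧ MvPolynomial.eval x f = 0 := by
      rw [hzero, criticalWeights, positiveWeights]
      simp only [Set.mem_ofPred_eq, P_one_eq_eval_detPoly, Complex.ofReal_eq_zero]
    have hf0 : f ≠ 0 := by
      rintro rfl
      rw [hf] at hw₁
      simp at hw₁
    have hdeg : ∀ d ∈ f.support, ∀ e, d e ≤ 1 := fun d hd e => degree_le_one hf hd e
    have key := zeros_subset_closure_eval_ne_zero f (secondDerivPoly o)
      {e : Edge m n | e.IsRowEdge} hf0 hdeg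
      (fun x hx hfx h => exists_isRowEdge_pderiv_ne_zero hf hx hfx h) (fun e he => by
        obtain ⟨w, w', hw, hw2, hww', hw'⟩ := exists_critical_weights o he
        -- Were `∂f/∂e` zero at `w`, changing only coordinate `e` would keep `f` zero, but `f` is
        -- nonzero at `w'`.
        refine ⟨w, (hzero w).mpr hw, fun hpd => hw' ?_, hw2⟩
        have hup : w' = Function.update w e (w' e) := by
          ext e'
          by_cases h : e' = e
          · subst h; simp
          · rw [Function.update_of_ne h, hww' e' h]
        rw [← hzero, hup, eval_update_of_degree_le_one f e (fun d hd => hdeg d hd e), hpd,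
          (hzero w).mpr hw]
        simp)
    simpa only [hcrit, Set.subset_def, Set.mem_ofPred_eq] using key
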